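/- \textbf{Proposition.} Fix a cancellation factor $f\ge 0$. An \emph{instance} consists of $n\in\mathbb{N}$ independent random variables $X_1,\dots,X_n$ with known distributions, revealed one by one in this order. An \emph{online policy} (possibly randomized, with private randomness independent of $X_1,\dots,X_n$) may depend on the instance and decides in each round $i$, knowing only $X_1,\dots,X_i$ and its private randomness, whether to accept $X_i$; if it accepts, any value held before is revoked. If the accepted rounds are $i_1<\dots<i_m$, the \emph{net reward} is $X_{i_m}-f\sum_{l<m}X_{i_l}$ (and $0$ if $m=0$). A number $\alpha\in\mathbb{R}$ is \emph{achieved} on an instance if some online policy has expected net reward at least $\alpha\,\mathbb{E}[\max_i X_i]$. Let $\alpha=\alpha(f)\in\mathbb{R}$. If $\alpha$ is achieved on every instance with $X_i=v_i\cdot\mathrm{Ber}(q_i)$, where $n\in\mathbb{N}$, $0<v_1\le v_2\le\dots\le v_n$, $q_i\in[0,1]$, and $\mathrm{Ber}(q_i)$ is a $0/1$-Bernoulli random variable with expectation $q_i$, then $\alpha$ is achieved on every instance with independent nonnegative random variables $X_1,\dots,X_n$ of finite expectation. -/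

import Mathlib

open MeasureTheory ProbabilityTheory

/-- A (possibly randomized) online policy for `n` rounds.  Before round `0` it draws a private seed,
uniform on `[0,1]`; in round `i` it decides whether to accept `X i`, knowing only the seed and the
values revealed in the rounds `j ≤ i`.  (Its own earlier decisions are determined by this
information.)  Accepting `X i` revokes the value held at that time, if there is one. -/
structure OnlinePolicy (n : ℕ) where
  /-- the decision in round `i`, as a function of the seed and of the values revealed so far -/
  accept : (i : Fin n) → unitInterval × ({j : Fin n // j ≤ i} → ℝ) → Bool
  measurable_accept : ∀ i, Measurable (accept i)

namespace OnlinePolicy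

variable {n : ℕ}

/-- The set of rounds in which the policy accepts, for the seed `s` and the realization `x`. -/
def accepted (π : OnlinePolicy n) (s : unitInterval) (x : Fin n → ℝ) : Finset (Fin n) :=
  Finset.univ.filter fun i => π.accept i (s, fun j => x j) = true

/-- The net reward with cancellation (buyback) factor `f`: the value accepted last, minus the cost
`f * x j` for every other accepted value `x j`; it is `0` if nothing is accepted. -/
noncomputable def netReward (π : OnlinePolicy n) (f : ℝ) (s : unitInterval) (x : Fin n → ℝ) : ℝ :=
  if h : (π.accepted s x).Nonempty then
    x ((π.accepted s x).max' h) -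
      ∑ j ∈ (π.accepted s x).erase ((π.accepted s x).max' h), f * x j
  else 0

/-- The expected net reward when `X i` has law `D i` and the `X i` are independent of each other and
of the seed. -/
noncomputable def expectedReward (π : OnlinePolicy n) (f : ℝ) (D : Fin n → Measure ℝ) : ℝ :=
  ∫ p, π.netReward f p.1 p.2 ∂((volume : Measure unitInterval).prod (Measure.pi D))

end OnlinePolicy

/-- The prophet benchmark `E[max_i X_i]` for independent `X i` with laws `D i`
(for `n = 0` the maximum is `0`). -/
noncomputable def prophetValue {n : ℕ} (D : Fin n → Measure ℝ) : ℝ :=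
  ∫ x, (⨆ i, x i) ∂(Measure.pi D)

/-- On the instance `D`, some online policy has expected net reward at least `α` times the prophet
benchmark. -/
def AchievesRatio (f α : ℝ) {n : ℕ} (D : Fin n → Measure ℝ) : Prop :=
  ∃ π : OnlinePolicy n, α * prophetValue D ≤ π.expectedReward f D

/-- The law of `v * Ber(q)`: the value `v` with probability `q`, and `0` with probability `1 - q`. -/
noncomputable def scaledBernoulli (v : ℝ) (q : unitInterval) : Measure ℝ :=
  bernoulliMeasure v 0 q

/-! Optimal play is a dynamic program. If `U h` is the optimal expected final reward while holding
`h`, prepending a round with prize X replaces `U h` by E[max (U h) (U X - f h)] (`bellman`). For `f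
= 0` the same recursion computes the expected maximum (`prophetValue_eq_value`). Hence achieving `α`
is an inequality between `value f` and `α * value 0` on one list of laws (`achievesRatio_iff`).

For `α ≥ 0` it is enough to turn any instance into an increasing Bernoulli instance such that, up to
arbitrarily small errors, the value for `f` does not rise and the value for `0` does not fall. This
takes three moves. Approximate each law in L¹ by a positive one of finite support. Split each finite
law into Bernoulli rounds with the same maximum, in decreasing order
(`exists_bernoulliRounds_of_finset`). Sort all Bernoulli rounds increasingly by adjacent swaps
(`bellman_scaledBernoulli_swap_le`). The maximum ignores the order, while the policy suffers when
small values come first.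

All comparisons rest on the shape of `U`: it is convex with slopes between `-f` and `1`, and every
round preserves this (`IsContinuationValue.bellman`). -/

/-- The laws of nonnegative random variables of finite expectation. -/
structure IsPrizeLaw (D : Measure ℝ) : Prop where
  isProbabilityMeasure : IsProbabilityMeasure D
  nonneg : ∀ᵐ x ∂D, 0 ≤ x
  integrable : Integrable (fun x : ℝ => x) D

/-! ### Value functions and the Bellman operator -/

/-- The shape of the expected final reward of optimal play, as a function of the value held. -/
structure IsContinuationValue (f : ℝ) (U : ℝ → ℝ) : Prop where
  convexOn : ConvexOn ℝ Set.univ U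
  monotone : Monotone fun h => U h + f * h
  antitone : Antitone fun h => U h - h

/-- The Bellman operator of a round with law `D`: `U` is the value function after the round. -/
noncomputable def bellman (f : ℝ) (D : Measure ℝ) (U : ℝ → ℝ) (h : ℝ) : ℝ :=
  ∫ x, max (U h) (U x - f * h) ∂D

namespace IsContinuationValue

variable {f : ℝ} {U : ℝ → ℝ}

theorem id (hf : 0 ≤ f) : IsContinuationValue f id where
  convexOn := convexOn_id convex_univ
  monotone := fun a b hab => by
    have := mul_le_mul_of_nonneg_left hab hf
    simp only [id_eq]; linarith
  antitone := fun a b _ => by simp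

theorem abs_sub_le (hf : 0 ≤ f) (hU : IsContinuationValue f U) (x y : ℝ) :
    |U x - U y| ≤ (1 + f) * |x - y| := by
  wlog h : y ≤ x generalizing x y
  · rw [abs_sub_comm, abs_sub_comm x]
    exact this y x (le_of_not_ge h)
  have h1 := hU.monotone h
  have h2 := hU.antitone h
  simp only at h1 h2
  have h3 : 0 ≤ f * (x - y) := mul_nonneg hf (sub_nonneg.2 h)
  rw [abs_of_nonneg (sub_nonneg.2 h), abs_le]
  constructor <;> linarith

theorem continuous (hf : 0 ≤ f) (hU : IsContinuationValue f U) : Continuous U := by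
  refine (LipschitzWith.of_dist_le_mul (K := ⟨1 + f, by positivity⟩) fun x y => ?_).continuous
  rw [Real.dist_eq, Real.dist_eq]
  exact hU.abs_sub_le hf x y

theorem integrable_comp (hf : 0 ≤ f) (hU : IsContinuationValue f U) {Ω : Type*}
    [MeasurableSpace Ω] {μ : Measure Ω} [IsFiniteMeasure μ] {X : Ω → ℝ} (hX : Integrable X μ) :
    Integrable (fun ω => U (X ω)) μ := by
  refine Integrable.mono' (g := fun ω => (1 + f) * |X ω| + |U 0|)
    ((hX.abs.const_mul _).add (integrable_const _))
    ((hU.continuous hf).comp_aestronglyMeasurable hX.aestronglyMeasurable) (ae_of_all _ fun ω => ?_)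
  have h1 := hU.abs_sub_le hf (X ω) 0
  have h2 := abs_sub_abs_le_abs_sub (U (X ω)) (U 0)
  rw [sub_zero] at h1
  rw [Real.norm_eq_abs]; linarith

theorem integrable_bellman (hf : 0 ≤ f) (hU : IsContinuationValue f U) {Ω : Type*}
    [MeasurableSpace Ω] {μ : Measure Ω} [IsFiniteMeasure μ] {X : Ω → ℝ} (hX : Integrable X μ)
    (h : ℝ) : Integrable (fun ω => max (U h) (U (X ω) - f * h)) μ :=
  (integrable_const _).sup ((hU.integrable_comp hf hX).sub (integrable_const _))

/-- Exchanging the held value for a smaller one never helps. -/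
theorem sub_le_of_le (hf : 0 ≤ f) (hU : IsContinuationValue f U) {v h : ℝ} (hv : 0 ≤ v)
    (hvh : v ≤ h) : U v - f * h ≤ U h := by
  have h1 := hU.monotone hvh
  have h2 := mul_nonneg hf hv
  simp only at h1; linarith

/-- If accepting `v` helps, then accepting a larger value `w` helps even more. -/
theorem sub_le_max (hf : 0 ≤ f) (hU : IsContinuationValue f U) {v w h : ℝ} (hv : 0 ≤ v)
    (hvw : v ≤ w) (hh : 0 ≤ h) : U v - f * h ≤ max (U h) (U w - f * h) := by
  rcases le_total v h with hvh | hvh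
  · exact (hU.sub_le_of_le hf hv hvh).trans (le_max_left _ _)
  -- As `v` lies between `h` and `w`, convexity bounds `U v` by the larger of `U h` and `U w`.
  · have h1 := hU.convexOn.le_max_of_mem_Icc (Set.mem_univ h) (Set.mem_univ w) ⟨hvh, hvw⟩
    have h2 := mul_nonneg hf hh
    rcases le_max_iff.1 h1 with h3 | h3
    · exact le_max_of_le_left (by linarith)
    · exact le_max_of_le_right (by linarith)

/-- For a fixed prize, declining and accepting are both convex in `h` with slopes between `-f` and
`1`. Maxima and averages preserve this. -/
theorem bellman (hf : 0 ≤ f) (hU : IsContinuationValue f U) {D : Measure ℝ} (hD : IsPrizeLaw D) :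
    IsContinuationValue f (bellman f D U) := by
  have := hD.isProbabilityMeasure
  have hi := hU.integrable_bellman hf hD.integrable
  refine ⟨⟨convex_univ, fun x _ y _ a b ha hb hab => ?_⟩, fun x y hxy => ?_, fun x y hxy => ?_⟩
  · simp only [_root_.bellman, smul_eq_mul]
    rw [← integral_const_mul, ← integral_const_mul,
      ← integral_add ((hi x).const_mul a) ((hi y).const_mul b)]
    refine integral_mono (hi _) (((hi x).const_mul a).add ((hi y).const_mul b)) fun t => ?_
    have hc := hU.convexOn.2 (Set.mem_univ x) (Set.mem_univ y) ha hb hab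
    simp only [smul_eq_mul] at hc
    have hx := le_max_left (U x) (U t - f * x)
    have hx' := le_max_right (U x) (U t - f * x)
    have hy := le_max_left (U y) (U t - f * y)
    have hy' := le_max_right (U y) (U t - f * y)
    refine max_le ?_ ?_
    · exact hc.trans (add_le_add (mul_le_mul_of_nonneg_left hx ha)
        (mul_le_mul_of_nonneg_left hy hb))
    · refine le_trans (le_of_eq ?_) (add_le_add (mul_le_mul_of_nonneg_left hx' ha)
        (mul_le_mul_of_nonneg_left hy' hb))
      linear_combination (-U t) * hab
  · simp only [_root_.bellman]
    have h1 := hU.monotone hxy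
    simp only at h1
    have : ∫ t, max (U x) (U t - f * x) ∂D ≤ ∫ t, (max (U y) (U t - f * y) + f * (y - x)) ∂D := by
      refine integral_mono (hi x) ((hi y).add (integrable_const _)) fun t => ?_
      have := le_max_left (U y) (U t - f * y)
      have := le_max_right (U y) (U t - f * y)
      exact max_le (by linarith) (by linarith)
    rw [integral_add (hi y) (integrable_const _)] at this
    simp only [integral_const, probReal_univ, one_smul] at this
    linarith
  · simp only [_root_.bellman]
    have h1 := hU.antitone hxy
    simp only at h1
    have h2 := mul_le_mul_of_nonneg_left hxy hf
    have : ∫ t, max (U y) (U t - f * y) ∂D ≤ ∫ t, (max (U x) (U t - f * x) + (y - x)) ∂D := by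
      refine integral_mono (hi y) ((hi x).add (integrable_const _)) fun t => ?_
      have := le_max_left (U x) (U t - f * x)
      have := le_max_right (U x) (U t - f * x)
      exact max_le (by linarith) (by linarith)
    rw [integral_add (hi x) (integrable_const _)] at this
    simp only [integral_const, probReal_univ, one_smul] at this
    linarith

end IsContinuationValue

variable {f : ℝ} {U W : ℝ → ℝ}

/-- Prizes are almost surely nonnegative, so comparing `U` and `W` at nonnegative held values is
enough, and a constant error passes through unchanged. -/
theorem bellman_le_add (hf : 0 ≤ f) (hU : IsContinuationValue f U) (hW : IsContinuationValue f W)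
    {c : ℝ} (hUW : ∀ h, 0 ≤ h → U h ≤ W h + c) {D : Measure ℝ} (hD : IsPrizeLaw D)
    {h : ℝ} (hh : 0 ≤ h) : bellman f D U h ≤ bellman f D W h + c := by
  have := hD.isProbabilityMeasure
  have hi := hW.integrable_bellman hf hD.integrable h
  have : ∫ x, max (U h) (U x - f * h) ∂D ≤ ∫ x, (max (W h) (W x - f * h) + c) ∂D := by
    refine integral_mono_ae (hU.integrable_bellman hf hD.integrable h)
      (hi.add (integrable_const _)) ?_
    filter_upwards [hD.nonneg] with x hx
    rw [← max_add_add_right]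
    exact max_le_max (hUW h hh) (by linarith [hUW x hx])
  rwa [integral_add hi (integrable_const _), integral_const, probReal_univ, one_smul] at this

theorem bellman_mono (hf : 0 ≤ f) (hU : IsContinuationValue f U) (hW : IsContinuationValue f W)
    (hUW : ∀ h, 0 ≤ h → U h ≤ W h) {D : Measure ℝ} (hD : IsPrizeLaw D)
    {h : ℝ} (hh : 0 ≤ h) : bellman f D U h ≤ bellman f D W h := by
  simpa using bellman_le_add hf hU hW (c := 0) (by simpa using hUW) hD hh

theorem le_bellman (hf : 0 ≤ f) (hU : IsContinuationValue f U) {D : Measure ℝ}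
    (hD : IsPrizeLaw D) (h : ℝ) : U h ≤ bellman f D U h := by
  have := hD.isProbabilityMeasure
  calc U h = ∫ _, U h ∂D := by simp
    _ ≤ _ := integral_mono (integrable_const _) (hU.integrable_bellman hf hD.integrable h)
      fun x => le_max_left _ _

/-- The value of optimal play in the rounds `L`, if `U` is the value function after them. -/
noncomputable def value (f : ℝ) (L : List (Measure ℝ)) (U : ℝ → ℝ) : ℝ → ℝ :=
  L.foldr (bellman f) U

@[simp] theorem value_nil (f : ℝ) (U : ℝ → ℝ) : value f [] U = U := rfl

@[simp] theorem value_cons (f : ℝ) (D : Measure ℝ) (L : List (Measure ℝ)) (U : ℝ → ℝ) :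
    value f (D :: L) U = bellman f D (value f L U) := rfl

theorem value_append (f : ℝ) (L M : List (Measure ℝ)) (U : ℝ → ℝ) :
    value f (L ++ M) U = value f L (value f M U) :=
  List.foldr_append

theorem IsContinuationValue.value (hf : 0 ≤ f) (hU : IsContinuationValue f U)
    {L : List (Measure ℝ)} (hL : ∀ D ∈ L, IsPrizeLaw D) : IsContinuationValue f (value f L U) := by
  induction L with
  | nil => exact hU
  | cons D L ih =>
    rw [List.forall_mem_cons] at hL
    exact (ih hL.2).bellman hf hL.1

theorem le_value (hf : 0 ≤ f) (hU : IsContinuationValue f U) {L : List (Measure ℝ)}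
    (hL : ∀ D ∈ L, IsPrizeLaw D) (h : ℝ) : U h ≤ value f L U h := by
  induction L with
  | nil => exact le_rfl
  | cons D L ih =>
    rw [List.forall_mem_cons] at hL
    exact (ih hL.2).trans (le_bellman hf (hU.value hf hL.2) hL.1 h)

theorem value_le_add (hf : 0 ≤ f) (hU : IsContinuationValue f U) (hW : IsContinuationValue f W)
    {c : ℝ} (hUW : ∀ h, 0 ≤ h → U h ≤ W h + c) {L : List (Measure ℝ)}
    (hL : ∀ D ∈ L, IsPrizeLaw D) : ∀ h, 0 ≤ h → value f L U h ≤ value f L W h + c := by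
  induction L with
  | nil => exact hUW
  | cons D L ih =>
    rw [List.forall_mem_cons] at hL
    exact fun h hh => bellman_le_add hf (hU.value hf hL.2) (hW.value hf hL.2) (ih hL.2) hL.1 hh

/-! ### Bernoulli rounds and adjacent swaps -/

theorem isPrizeLaw_scaledBernoulli {v : ℝ} (hv : 0 ≤ v) (q : unitInterval) :
    IsPrizeLaw (scaledBernoulli v q) where
  isProbabilityMeasure := by unfold scaledBernoulli; infer_instance
  nonneg := by
    rw [scaledBernoulli, bernoulliMeasure_def]
    refine ae_add_measure_iff.2 ⟨?_, ?_⟩ <;> refine Measure.ae_smul_measure ?_ _ <;> simp [hv]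
  integrable := by
    rw [scaledBernoulli, bernoulliMeasure_def]
    exact (Integrable.smul_measure_nnreal (integrable_dirac (by simp))).add_measure
      (Integrable.smul_measure_nnreal (integrable_dirac (by simp)))

theorem integral_scaledBernoulli (v : ℝ) (q : unitInterval) (g : ℝ → ℝ) :
    ∫ x, g x ∂(scaledBernoulli v q) = q * g v + (1 - q) * g 0 := by
  rw [scaledBernoulli, integral_bernoulliMeasure]
  simp

theorem bellman_scaledBernoulli (hf : 0 ≤ f) (hU : IsContinuationValue f U) (v : ℝ)
    (q : unitInterval) {h : ℝ} (hh : 0 ≤ h) :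
    bellman f (scaledBernoulli v q) U h = q * max (U h) (U v - f * h) + (1 - q) * U h := by
  rw [bellman, integral_scaledBernoulli, max_eq_left (hU.sub_le_of_le hf le_rfl hh)]

theorem IsContinuationValue.mono_of_zero (hU : IsContinuationValue 0 U) : Monotone U := by
  simpa using hU.monotone

/-- For `f = 0` the function `U` is monotone, so the better choice is to hold the running maximum.
-/
theorem bellman_zero_scaledBernoulli (hU : IsContinuationValue 0 U) (v : ℝ)
    (q : unitInterval) {h : ℝ} (hh : 0 ≤ h) :
    bellman 0 (scaledBernoulli v q) U h = q * U (max h v) + (1 - q) * U h := by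
  rw [bellman_scaledBernoulli le_rfl hU v q hh, hU.mono_of_zero.map_max]
  simp

/-- Of two adjacent Bernoulli rounds, it is worse to have the smaller value first. -/
theorem bellman_scaledBernoulli_swap_le (hf : 0 ≤ f) (hU : IsContinuationValue f U) {v w : ℝ}
    (hv : 0 ≤ v) (hvw : v ≤ w) (q r : unitInterval) {h : ℝ} (hh : 0 ≤ h) :
    bellman f (scaledBernoulli v q) (bellman f (scaledBernoulli w r) U) h ≤
      bellman f (scaledBernoulli w r) (bellman f (scaledBernoulli v q) U) h := by
  have hw := hv.trans hvw
  rw [bellman_scaledBernoulli hf (hU.bellman hf (isPrizeLaw_scaledBernoulli hw r)) v q hh,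
    bellman_scaledBernoulli hf (hU.bellman hf (isPrizeLaw_scaledBernoulli hv q)) w r hh,
    bellman_scaledBernoulli hf hU w r hh, bellman_scaledBernoulli hf hU v q hh,
    bellman_scaledBernoulli hf hU w r hv, bellman_scaledBernoulli hf hU v q hw,
    max_eq_left (hU.sub_le_of_le hf hv hvw)]
  have hq0 : (0 : ℝ) ≤ q := q.2.1
  have hq1 : (0 : ℝ) ≤ 1 - q := sub_nonneg.2 q.2.2
  have hr0 : (0 : ℝ) ≤ r := r.2.1
  have hr1 : (0 : ℝ) ≤ 1 - r := sub_nonneg.2 r.2.2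
  have hkey := hU.sub_le_max hf hv hvw hh
  have hfv := mul_nonneg hf hv
  set m := max (U h) (U w - f * h) with hm
  set k := max (U h) (U v - f * h) with hk
  have hm1 : U h ≤ m := le_max_left _ _
  have hm2 : U w - f * h ≤ m := le_max_right _ _
  have hk1 : U h ≤ k := le_max_left _ _
  have hk2 : U v - f * h ≤ k := le_max_right _ _
  -- Both orders are compared with the reward of seeing both values at once and responding only to
  -- `w` when it shows up: `r * m + (1 - r) * (q * k + (1 - q) * U h)`. This step bounds the order
  -- `v`, `w` from above by it, and `hright` bounds the order `w`, `v` from below.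
  have hleft : max (r * m + (1 - r) * U h)
      (r * max (U v) (U w - f * v) + (1 - r) * U v - f * h) ≤ r * m + (1 - r) * k := by
    refine max_le (by gcongr) ?_
    have h1 : max (U v) (U w - f * v) ≤ m + f * h := max_le (by linarith) (by linarith)
    have h2 := mul_le_mul_of_nonneg_left h1 hr0
    have h3 := mul_le_mul_of_nonneg_left hk2 hr1
    linarith
  have hright : m ≤ max (q * k + (1 - q) * U h) ((q * U w + (1 - q) * U w) - f * h) := by
    refine max_le_max ?_ (by linarith)
    have := mul_le_mul_of_nonneg_left hk1 hq0
    linarith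
  have h1 := mul_le_mul_of_nonneg_left hleft hq0
  have h2 := mul_le_mul_of_nonneg_left hright hr0
  linarith

/-- Without cancellation costs the order of Bernoulli rounds is irrelevant. -/
theorem bellman_zero_scaledBernoulli_comm (hU : IsContinuationValue 0 U) {v w : ℝ}
    (hv : 0 ≤ v) (hw : 0 ≤ w) (q r : unitInterval) {h : ℝ} (hh : 0 ≤ h) :
    bellman 0 (scaledBernoulli v q) (bellman 0 (scaledBernoulli w r) U) h =
      bellman 0 (scaledBernoulli w r) (bellman 0 (scaledBernoulli v q) U) h := by
  rw [bellman_zero_scaledBernoulli (hU.bellman le_rfl (isPrizeLaw_scaledBernoulli hw r)) v q hh,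
    bellman_zero_scaledBernoulli (hU.bellman le_rfl (isPrizeLaw_scaledBernoulli hv q)) w r hh,
    bellman_zero_scaledBernoulli hU w r hh, bellman_zero_scaledBernoulli hU v q hh,
    bellman_zero_scaledBernoulli hU w r (le_max_of_le_left hh),
    bellman_zero_scaledBernoulli hU v q (le_max_of_le_left hh), max_right_comm]
  ring

/-- The laws of a sequence of Bernoulli rounds, given by their values and probabilities. -/
noncomputable def bernoulliRounds (L : List (ℝ × unitInterval)) : List (Measure ℝ) :=
  L.map fun b => scaledBernoulli b.1 b.2

@[simp] theorem bernoulliRounds_nil : bernoulliRounds [] = [] := rfl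

@[simp] theorem bernoulliRounds_cons (b : ℝ × unitInterval) (L : List (ℝ × unitInterval)) :
    bernoulliRounds (b :: L) = scaledBernoulli b.1 b.2 :: bernoulliRounds L := rfl

theorem bernoulliRounds_append (L M : List (ℝ × unitInterval)) :
    bernoulliRounds (L ++ M) = bernoulliRounds L ++ bernoulliRounds M :=
  List.map_append

theorem isPrizeLaw_of_mem_bernoulliRounds {L : List (ℝ × unitInterval)} (hL : ∀ b ∈ L, 0 < b.1) :
    ∀ D ∈ bernoulliRounds L, IsPrizeLaw D := by
  simp only [bernoulliRounds, List.mem_map, forall_exists_index, and_imp, forall_apply_eq_imp_iff₂]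
  exact fun b hb => isPrizeLaw_scaledBernoulli (hL b hb).le b.2

/-! ### Splitting and approximating general rounds -/

/-- Splitting a round of finite support into Bernoulli rounds with the same maximum, in decreasing
order of their values, does not increase the value. -/
theorem exists_bernoulliRounds_of_finset (s : Finset ℝ) : (∀ y ∈ s, 0 < y) → ∀ p : ℝ → ℝ,
    (∀ y ∈ s, 0 ≤ p y) → ∑ y ∈ s, p y ≤ 1 → ∃ L : List (ℝ × unitInterval), (∀ b ∈ L, 0 < b.1) ∧
      (∀ f U, 0 ≤ f → IsContinuationValue f U → ∀ h, 0 ≤ h → value f (bernoulliRounds L) U h ≤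
        (1 - ∑ y ∈ s, p y) * U h + ∑ y ∈ s, p y * max (U h) (U y - f * h)) ∧
      ∀ U, IsContinuationValue 0 U → ∀ h, 0 ≤ h → value 0 (bernoulliRounds L) U h =
        (1 - ∑ y ∈ s, p y) * U h + ∑ y ∈ s, p y * U (max h y) := by
  induction s using Finset.induction_on_max with
  | empty => exact fun _ p _ _ => ⟨[], by simp, by simp, by simp⟩
  | insert a s has ih =>
    intro hs p hp hsum
    have hna : a ∉ s := fun h => lt_irrefl _ (has a h)
    rw [Finset.sum_insert hna] at hsum
    have hpa : 0 ≤ p a := hp a (Finset.mem_insert_self _ _)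
    have hps : ∀ y ∈ s, 0 ≤ p y := fun y hy => hp y (Finset.mem_insert_of_mem hy)
    have hs0 : 0 ≤ ∑ y ∈ s, p y := Finset.sum_nonneg hps
    have ha : 0 < a := hs a (Finset.mem_insert_self _ _)
    have hsy : ∀ y ∈ s, 0 < y := fun y hy => hs y (Finset.mem_insert_of_mem hy)
    have hpa1 : 0 ≤ 1 - p a := by linarith
    -- Probabilities conditioned on the maximal value `a` not occurring. If `p a = 1`, the division
    -- gives `0`, consistent with `p y = 0` on `s`.
    set p' : ℝ → ℝ := fun y => p y / (1 - p a) with hp'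
    have hp's : ∀ y ∈ s, 0 ≤ p' y := fun y hy => div_nonneg (hps y hy) hpa1
    have hsum' : ∑ y ∈ s, p' y ≤ 1 := by
      rw [← Finset.sum_div]
      exact div_le_one_of_le₀ (by linarith) hpa1
    have hmul : ∀ y ∈ s, (1 - p a) * p' y = p y := by
      intro y hy
      rcases hpa1.eq_or_lt with h | h
      · have := Finset.single_le_sum hps hy
        have := hps y hy
        rw [← h, zero_mul]; linarith
      · exact mul_div_cancel₀ _ h.ne'
    have hmulsum : (1 - p a) * ∑ y ∈ s, p' y = ∑ y ∈ s, p y := by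
      rw [Finset.mul_sum]; exact Finset.sum_congr rfl hmul
    have hcomb : ∀ u : ℝ, ∀ g : ℝ → ℝ,
        (1 - p a) * ((1 - ∑ y ∈ s, p' y) * u + ∑ y ∈ s, p' y * g y) =
          (1 - (p a + ∑ y ∈ s, p y)) * u + ∑ y ∈ s, p y * g y := by
      intro u g
      have : (1 - p a) * ∑ y ∈ s, p' y * g y = ∑ y ∈ s, p y * g y := by
        rw [Finset.mul_sum]
        exact Finset.sum_congr rfl fun y hy => by rw [← mul_assoc, hmul y hy]
      linear_combination this - u * hmulsum
    have hconst : ∀ u : ℝ, ∀ g : ℝ → ℝ, (∀ y ∈ s, g y ≤ u) →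
        (1 - ∑ y ∈ s, p' y) * u + ∑ y ∈ s, p' y * g y ≤ u := by
      intro u g hg
      have : ∑ y ∈ s, p' y * g y ≤ ∑ y ∈ s, p' y * u :=
        Finset.sum_le_sum fun y hy => mul_le_mul_of_nonneg_left (hg y hy) (hp's y hy)
      rw [← Finset.sum_mul] at this
      linarith
    obtain ⟨L, hL, hle, heq⟩ := ih hsy p' hp's hsum'
    have hLD := isPrizeLaw_of_mem_bernoulliRounds hL
    refine ⟨(a, ⟨p a, hpa, by linarith⟩) :: L, List.forall_mem_cons.2 ⟨ha, hL⟩, ?_, ?_⟩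
    · intro f U hf hU h hh
      rw [bernoulliRounds_cons, value_cons, bellman_scaledBernoulli hf (hU.value hf hLD) _ _ hh,
        Finset.sum_insert hna, Finset.sum_insert hna]
      have h1 := hle f U hf hU h hh
      have h2 := hle f U hf hU a ha.le
      -- While `a` is held, the later, smaller values are useless. If `a` was declined, they yield
      -- no more than the better of keeping `h` and taking `a` (`h4`).
      have h3 := hconst (U a) (fun y => max (U a) (U y - f * a)) fun y hy =>
        max_le le_rfl (hU.sub_le_of_le hf (hsy y hy).le (has y hy).le)
      have h4 : (1 - ∑ y ∈ s, p' y) * U h + ∑ y ∈ s, p' y * max (U h) (U y - f * h) ≤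
          max (U h) (U a - f * h) := by
        refine le_trans (add_le_add (mul_le_mul_of_nonneg_left (le_max_left _ (U a - f * h))
          (sub_nonneg.2 hsum')) le_rfl) (hconst _ _ fun y hy => max_le (le_max_left _ _)
            (hU.sub_le_max hf (hsy y hy).le (has y hy).le hh))
      have h5 : max (value f (bernoulliRounds L) U h) (value f (bernoulliRounds L) U a - f * h) ≤
          max (U h) (U a - f * h) :=
        max_le (h1.trans h4) ((sub_le_sub_right (h2.trans h3) _).trans (le_max_right _ _))
      have h6 := mul_le_mul_of_nonneg_left h5 hpa
      have h7 := mul_le_mul_of_nonneg_left h1 hpa1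
      have h8 := hcomb (U h) fun y => max (U h) (U y - f * h)
      simp only at h6 h7 h8 ⊢
      linarith
    · intro U hU h hh
      rw [bernoulliRounds_cons, value_cons,
        bellman_zero_scaledBernoulli (hU.value le_rfl hLD) _ _ hh, heq U hU h hh,
        heq U hU _ (le_max_of_le_left hh), Finset.sum_insert hna, Finset.sum_insert hna]
      have h1 : ∑ y ∈ s, p' y * U (max (max h a) y) = ∑ y ∈ s, p' y * U (max h a) :=
        Finset.sum_congr rfl fun y hy => by
          rw [max_eq_left ((has y hy).le.trans (le_max_right h a))]
      rw [← Finset.sum_mul] at h1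
      have h2 := hcomb (U h) fun y => U (max h y)
      simp only at h1 h2 ⊢
      linear_combination p a * h1 + h2

theorem integral_comp_simpleFunc {μ : Measure ℝ} [IsFiniteMeasure μ] (φ : SimpleFunc ℝ ℝ)
    (g : ℝ → ℝ) : ∫ x, g (φ x) ∂μ = ∑ y ∈ φ.range, μ.real (φ ⁻¹' {y}) * g y := by
  have h : ∀ x, g (φ x) = ∑ y ∈ φ.range, (φ ⁻¹' {y}).indicator (fun _ => g y) x := by
    intro x
    rw [Finset.sum_eq_single (φ x)]
    · simp
    · intro y _ hy
      exact Set.indicator_of_notMem (fun h => hy (by simpa using h.symm)) _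
    · exact fun hx => absurd (φ.mem_range_self x) hx
  simp_rw [h]
  rw [integral_finsetSum _ fun y _ => (integrable_const _).indicator (φ.measurableSet_fiber y)]
  exact Finset.sum_congr rfl fun y _ => by
    rw [integral_indicator_const _ (φ.measurableSet_fiber y), smul_eq_mul]

/-- Half of `δ` pays for the density of simple functions in L¹. The other half pays for raising
their values to at least `δ / 2`, which makes them positive as the Bernoulli values must be.
Nonnegativity of the prize keeps the second error small. -/
theorem IsPrizeLaw.exists_simpleFunc {D : Measure ℝ} (hD : IsPrizeLaw D) {δ : ℝ} (hδ : 0 < δ) :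
    ∃ φ : SimpleFunc ℝ ℝ, (∀ x, 0 < φ x) ∧ Integrable φ D ∧ ∫ x, |φ x - x| ∂D ≤ δ := by
  have := hD.isProbabilityMeasure
  obtain ⟨g, hg, hgL⟩ := (memLp_one_iff_integrable.2 hD.integrable).exists_simpleFunc_eLpNorm_sub_lt
    ENNReal.one_ne_top (ε := ENNReal.ofReal (δ / 2)) (by simpa using hδ)
  rw [memLp_one_iff_integrable] at hgL
  have hi : Integrable (fun x => x - g x) D := hD.integrable.sub hgL
  have hg' : ∫ x, |x - g x| ∂D ≤ δ / 2 := by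
    rw [eLpNorm_one_eq_lintegral_enorm] at hg
    have h1 := integral_norm_eq_lintegral_enorm hi.aestronglyMeasurable
    simp only [Real.norm_eq_abs] at h1
    rw [h1]
    exact ENNReal.toReal_le_of_le_ofReal (by positivity) hg.le
  have hφ : Integrable (g.map fun y => max y (δ / 2)) D :=
    hgL.sup (integrable_const (δ / 2))
  refine ⟨g.map fun y => max y (δ / 2), fun x => ?_, hφ, ?_⟩
  · exact lt_max_of_lt_right (half_pos hδ)
  · have : ∫ x, |(g.map fun y => max y (δ / 2)) x - x| ∂D ≤ ∫ x, (|x - g x| + δ / 2) ∂D := by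
      refine integral_mono_ae (hφ.sub hD.integrable).abs (hi.abs.add (integrable_const _)) ?_
      filter_upwards [hD.nonneg] with x hx
      have h1 := neg_abs_le (x - g x)
      have h2 := le_abs_self (x - g x)
      simp only [SimpleFunc.map_apply]
      rcases max_cases (g x) (δ / 2) with ⟨h, h'⟩ | ⟨h, h'⟩ <;> rw [h, abs_le] <;>
        constructor <;> linarith
    rw [integral_add hi.abs (integrable_const _)] at this
    simp only [integral_const, probReal_univ, one_smul] at this
    linarith

/-- A round can be approximated by Bernoulli rounds. -/
theorem IsPrizeLaw.exists_bernoulliRounds {D : Measure ℝ} (hD : IsPrizeLaw D) {δ : ℝ}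
    (hδ : 0 < δ) : ∃ L : List (ℝ × unitInterval), (∀ b ∈ L, 0 < b.1) ∧
      (∀ f U, 0 ≤ f → IsContinuationValue f U → ∀ h, 0 ≤ h →
        value f (bernoulliRounds L) U h ≤ bellman f D U h + (1 + f) * δ) ∧
      ∀ U, IsContinuationValue 0 U → ∀ h, 0 ≤ h →
        bellman 0 D U h ≤ value 0 (bernoulliRounds L) U h + δ := by
  have := hD.isProbabilityMeasure
  obtain ⟨φ, hpos, hφ, hle⟩ := hD.exists_simpleFunc hδ
  have hsum : ∑ y ∈ φ.range, D.real (φ ⁻¹' {y}) = 1 := by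
    have := integral_comp_simpleFunc (μ := D) φ fun _ => 1
    simpa using this.symm
  obtain ⟨L, hL, h1, h2⟩ := exists_bernoulliRounds_of_finset φ.range
    (by simpa [SimpleFunc.mem_range] using hpos) (fun y => D.real (φ ⁻¹' {y}))
    (fun y _ => measureReal_nonneg) hsum.le
  -- `U` is Lipschitz with constant `1 + f`, so an L¹ error `δ` in the prize costs at most `(1 + f)
  -- * δ`.
  have happrox : ∀ f U, 0 ≤ f → IsContinuationValue f U → ∀ h,
      |∫ x, max (U h) (U (φ x) - f * h) ∂D - bellman f D U h| ≤ (1 + f) * δ := by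
    intro f U hf hU h
    have hb := hU.integrable_bellman hf hD.integrable h
    rw [bellman, ← integral_sub (hU.integrable_bellman hf hφ h) hb]
    refine abs_integral_le_integral_abs.trans ?_
    refine le_trans (integral_mono ((hU.integrable_bellman hf hφ h).sub hb).abs
      ((hφ.sub hD.integrable).abs.const_mul (1 + f)) fun x => ?_)
      (by rw [integral_const_mul]; exact mul_le_mul_of_nonneg_left hle (by positivity))
    rw [max_comm (U h), max_comm (U h)]
    refine le_trans (abs_max_sub_max_le_abs _ _ _) ?_
    exact le_of_eq_of_le (by ring_nf) (hU.abs_sub_le hf (φ x) x)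
  refine ⟨L, hL, fun f U hf hU h hh => ?_, fun U hU h hh => ?_⟩
  · have h3 := h1 f U hf hU h hh
    rw [hsum, sub_self, zero_mul, zero_add,
      ← integral_comp_simpleFunc φ fun y => max (U h) (U y - f * h)] at h3
    linarith [(abs_le.1 (happrox f U hf hU h)).2]
  · have h3 := h2 U hU h hh
    rw [hsum, sub_self, zero_mul, zero_add, ← integral_comp_simpleFunc φ fun y => U (max h y)] at h3
    have h4 := (abs_le.1 (happrox 0 U le_rfl hU h)).1
    simp only [zero_mul, sub_zero, ← hU.mono_of_zero.map_max] at h4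
    rw [h3]; linarith

/-- Concatenating the approximations of the single rounds adds their errors. The list `L` does not
depend on `f`, so it serves both the policy and the benchmark. -/
theorem exists_bernoulliRounds_of_list {δ : ℝ} (hδ : 0 < δ) (Ds : List (Measure ℝ))
    (hDs : ∀ D ∈ Ds, IsPrizeLaw D) : ∃ L : List (ℝ × unitInterval), (∀ b ∈ L, 0 < b.1) ∧
      (∀ f U, 0 ≤ f → IsContinuationValue f U → ∀ h, 0 ≤ h →
        value f (bernoulliRounds L) U h ≤ value f Ds U h + Ds.length * ((1 + f) * δ)) ∧
      ∀ U, IsContinuationValue 0 U → ∀ h, 0 ≤ h →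
        value 0 Ds U h ≤ value 0 (bernoulliRounds L) U h + Ds.length * δ := by
  induction Ds with
  | nil => exact ⟨[], by simp⟩
  | cons D Ds ih =>
    rw [List.forall_mem_cons] at hDs
    obtain ⟨L, hL, h1, h2⟩ := ih hDs.2
    obtain ⟨M, hM, h3, h4⟩ := hDs.1.exists_bernoulliRounds hδ
    have hLD := isPrizeLaw_of_mem_bernoulliRounds hL
    have hMD := isPrizeLaw_of_mem_bernoulliRounds hM
    refine ⟨M ++ L, fun b hb => (List.mem_append.1 hb).elim (hM b) (hL b), ?_, ?_⟩
    · intro f U hf hU h hh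
      have h5 := value_le_add hf (hU.value hf hLD) (hU.value hf hDs.2) (h1 f U hf hU) hMD h hh
      have h6 := h3 f _ hf (hU.value hf hDs.2) h hh
      rw [bernoulliRounds_append, value_append, value_cons]
      push_cast [List.length_cons]
      linarith
    · intro U hU h hh
      have h5 := bellman_le_add le_rfl (hU.value le_rfl hDs.2) (hU.value le_rfl hLD)
        (h2 U hU) hDs.1 hh
      have h6 := h4 _ (hU.value le_rfl hLD) h hh
      rw [bernoulliRounds_append, value_append, value_cons]
      push_cast [List.length_cons]
      linarith

/-! ### Sorting the Bernoulli rounds -/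

/-- The insertion step of insertion sort: `b` moves back past smaller values, and each swap hurts
the policy but leaves the benchmark unchanged. -/
theorem exists_sorted_insert (b : ℝ × unitInterval) (hb : 0 < b.1) (L : List (ℝ × unitInterval))
    (hL : ∀ c ∈ L, 0 < c.1) (hs : L.Pairwise fun c d => c.1 ≤ d.1) :
    ∃ M : List (ℝ × unitInterval), M.Perm (b :: L) ∧ (M.Pairwise fun c d => c.1 ≤ d.1) ∧
      (∀ f U, 0 ≤ f → IsContinuationValue f U → ∀ h, 0 ≤ h →
        value f (bernoulliRounds M) U h ≤ value f (bernoulliRounds (b :: L)) U h) ∧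
      ∀ U, IsContinuationValue 0 U → ∀ h, 0 ≤ h →
        value 0 (bernoulliRounds (b :: L)) U h ≤ value 0 (bernoulliRounds M) U h := by
  induction L with
  | nil => exact ⟨[b], List.Perm.refl _, by simp, by simp, by simp⟩
  | cons c L ih =>
    rw [List.forall_mem_cons] at hL
    rw [List.pairwise_cons] at hs
    rcases le_total b.1 c.1 with hbc | hcb
    · refine ⟨b :: c :: L, List.Perm.refl _, ?_, fun _ _ _ _ _ _ => le_rfl, fun _ _ _ _ => le_rfl⟩
      refine List.pairwise_cons.2 ⟨List.forall_mem_cons.2 ⟨hbc, fun d hd => ?_⟩,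
        List.pairwise_cons.2 hs⟩
      exact hbc.trans (hs.1 d hd)
    · obtain ⟨M, hM, hMs, h1, h2⟩ := ih hL.2 hs.2
      have hMpos : ∀ d ∈ M, 0 < d.1 := fun d hd =>
        List.forall_mem_cons (p := fun d : ℝ × unitInterval => 0 < d.1).2 ⟨hb, hL.2⟩ d
          (hM.mem_iff.1 hd)
      have hbLD := isPrizeLaw_of_mem_bernoulliRounds (List.forall_mem_cons.2 ⟨hb, hL.2⟩)
      have hLD := isPrizeLaw_of_mem_bernoulliRounds hL.2
      have hMD := isPrizeLaw_of_mem_bernoulliRounds hMpos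
      have hcD := isPrizeLaw_scaledBernoulli hL.1.le c.2
      refine ⟨c :: M, (hM.cons c).trans (List.Perm.swap _ _ _), List.pairwise_cons.2
        ⟨fun d hd => ?_, hMs⟩, fun f U hf hU h hh => ?_, fun U hU h hh => ?_⟩
      · rcases List.mem_cons.1 (hM.mem_iff.1 hd) with rfl | hd
        · exact hcb
        · exact hs.1 d hd
      · refine (bellman_mono hf (hU.value hf hMD) (hU.value hf hbLD) (h1 f U hf hU) hcD hh).trans ?_
        exact bellman_scaledBernoulli_swap_le hf (hU.value hf hLD) hL.1.le hcb _ _ hh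
      · refine le_trans (le_of_eq ?_)
          (bellman_mono le_rfl (hU.value le_rfl hbLD) (hU.value le_rfl hMD) (h2 U hU) hcD hh)
        exact bellman_zero_scaledBernoulli_comm (hU.value le_rfl hLD) hb.le hL.1.le _ _ hh

theorem exists_sorted_bernoulliRounds (L : List (ℝ × unitInterval)) (hL : ∀ b ∈ L, 0 < b.1) :
    ∃ M : List (ℝ × unitInterval), M.Perm L ∧ (M.Pairwise fun c d => c.1 ≤ d.1) ∧
      (∀ f U, 0 ≤ f → IsContinuationValue f U → ∀ h, 0 ≤ h →
        value f (bernoulliRounds M) U h ≤ value f (bernoulliRounds L) U h) ∧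
      ∀ U, IsContinuationValue 0 U → ∀ h, 0 ≤ h →
        value 0 (bernoulliRounds L) U h ≤ value 0 (bernoulliRounds M) U h := by
  induction L with
  | nil => exact ⟨[], List.Perm.refl _, by simp, by simp, by simp⟩
  | cons b L ih =>
    rw [List.forall_mem_cons] at hL
    obtain ⟨M, hM, hMs, h1, h2⟩ := ih hL.2
    have hMpos : ∀ d ∈ M, 0 < d.1 := fun d hd => hL.2 d (hM.mem_iff.1 hd)
    obtain ⟨N, hN, hNs, h3, h4⟩ := exists_sorted_insert b hL.1 M hMpos hMs
    have hLD := isPrizeLaw_of_mem_bernoulliRounds hL.2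
    have hMD := isPrizeLaw_of_mem_bernoulliRounds hMpos
    have hbD := isPrizeLaw_scaledBernoulli hL.1.le b.2
    refine ⟨N, hN.trans (hM.cons b), hNs, fun f U hf hU h hh => ?_, fun U hU h hh => ?_⟩
    · exact (h3 f U hf hU h hh).trans
        (bellman_mono hf (hU.value hf hMD) (hU.value hf hLD) (h1 f U hf hU) hbD hh)
    · exact (bellman_mono le_rfl (hU.value le_rfl hLD) (hU.value le_rfl hMD) (h2 U hU)
        hbD hh).trans (h4 U hU h hh)

/-! ### The reduction for value functions -/

/-- A comparison of the optimal reward with the prophet's reward extends from Bernoulli rounds in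
increasing order of their values to all rounds. -/
theorem mul_value_zero_le_value {f α : ℝ} (hf : 0 ≤ f) (hα : 0 ≤ α)
    (hBer : ∀ L : List (ℝ × unitInterval), (∀ b ∈ L, 0 < b.1) →
      (L.Pairwise fun c d => c.1 ≤ d.1) →
      α * value 0 (bernoulliRounds L) id 0 ≤ value f (bernoulliRounds L) id 0)
    (Ds : List (Measure ℝ)) (hDs : ∀ D ∈ Ds, IsPrizeLaw D) :
    α * value 0 Ds id 0 ≤ value f Ds id 0 := by
  have key : ∀ δ : ℝ, 0 < δ →
      α * value 0 Ds id 0 ≤ value f Ds id 0 + Ds.length * (1 + f + α) * δ := by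
    intro δ hδ
    obtain ⟨L, hL, h1, h2⟩ := exists_bernoulliRounds_of_list hδ Ds hDs
    obtain ⟨M, hM, hMs, h3, h4⟩ := exists_sorted_bernoulliRounds L hL
    have h5 := h2 id (.id le_rfl) 0 le_rfl
    have h6 := h4 id (.id le_rfl) 0 le_rfl
    have h7 := h1 f id hf (.id hf) 0 le_rfl
    have h8 := h3 f id hf (.id hf) 0 le_rfl
    have h9 := hBer M (fun d hd => hL d (hM.mem_iff.1 hd)) hMs
    have h10 := mul_le_mul_of_nonneg_left (h5.trans (add_le_add_left h6 _)) hα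
    linarith
  set C := (Ds.length : ℝ) * (1 + f + α) with hC
  have hC0 : 0 ≤ C := by positivity
  -- `C` vanishes for the empty list, hence the denominator `C + 1`.
  refine le_of_forall_pos_le_add fun ε hε => (key (ε / (C + 1)) (by positivity)).trans ?_
  gcongr
  rw [← mul_div_assoc, div_le_iff₀ (by positivity)]
  nlinarith

/-! ### Decision rules and dynamic programming -/

/-- The reward collected in `n` rounds with decisions `a` and realization `x` when starting with
the held value `h`. -/
noncomputable def runReward (f : ℝ) : (n : ℕ) → ℝ → (Fin n → Bool) → (Fin n → ℝ) → ℝ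
  | 0, h, _, _ => h
  | n + 1, h, a, x =>
    if a 0 = true then runReward f n (x 0) (fun i => a i.succ) (fun i => x i.succ) - f * h
    else runReward f n h (fun i => a i.succ) (fun i => x i.succ)

theorem runReward_eq_of_forall_false (f : ℝ) : ∀ (n : ℕ) (h : ℝ) (a : Fin n → Bool)
    (x : Fin n → ℝ), (∀ i, a i = false) → runReward f n h a x = h
  | 0, _, _, _, _ => rfl
  | n + 1, h, a, x, ha => by
    simp only [runReward, ha 0, Bool.false_eq_true, if_false]
    exact runReward_eq_of_forall_false f n h _ _ fun i => ha i.succ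

/-- The recursion charges a value when it is replaced. As something is accepted, this hits `h` and
every accepted value except the last. -/
theorem runReward_eq_of_last (f : ℝ) : ∀ (n : ℕ) (h : ℝ) (a : Fin n → Bool) (x : Fin n → ℝ)
    (m : Fin n), a m = true → (∀ j, m < j → a j = false) →
    runReward f n h a x = x m - ∑ j, (if a j = true ∧ j ≠ m then f * x j else 0) - f * h
  | 0, _, _, _, m, _, _ => m.elim0
  | n + 1, h, a, x, m, ham, hlast => by
    rw [Fin.sum_univ_succ]
    cases m using Fin.cases with
    | zero =>
      have htail : ∀ i : Fin n, a i.succ = false := fun i => hlast _ (Fin.succ_pos i)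
      have h0 := runReward_eq_of_forall_false f n (x 0) _ (fun i => x i.succ) htail
      rw [runReward, if_pos ham, h0]
      simp [htail]
    | succ m =>
      have ih := fun h => runReward_eq_of_last f n h (fun i => a i.succ) (fun i => x i.succ) m ham
        fun j hj => hlast _ (Fin.succ_lt_succ_iff.2 hj)
      rcases h0 : a 0 with _ | _
      · simp [runReward, h0, ih]
      · simp [runReward, h0, ih, (Fin.succ_ne_zero m).symm]
        ring

/-- Starting empty-handed amounts to holding `0`: revoking it is free, and keeping it yields `0`. -/
theorem OnlinePolicy.netReward_eq_runReward {n : ℕ} (π : OnlinePolicy n) (f : ℝ)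
    (s : unitInterval) (x : Fin n → ℝ) :
    π.netReward f s x = runReward f n 0 (fun i => π.accept i (s, fun j => x j)) x := by
  have hmem : ∀ i, i ∈ π.accepted s x ↔ π.accept i (s, fun j => x j) = true := by
    simp [OnlinePolicy.accepted]
  unfold OnlinePolicy.netReward
  split_ifs with h
  · rw [runReward_eq_of_last f n 0 _ x ((π.accepted s x).max' h)
      ((hmem _).1 (Finset.max'_mem _ h)) fun j hj => ?_, mul_zero, sub_zero, ← Finset.sum_filter]
    · congr 2
      ext j
      simp [hmem, and_comm]
    · rw [← Bool.not_eq_true, ← hmem]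
      exact fun hj' => absurd (Finset.le_max' _ j hj') (not_le.2 hj)
  · rw [runReward_eq_of_forall_false]
    intro i
    rw [← Bool.not_eq_true, ← hmem]
    exact fun hi => h ⟨i, hi⟩

theorem measurable_runReward (f : ℝ) : ∀ n : ℕ,
    Measurable fun p : ℝ × (Fin n → Bool) × (Fin n → ℝ) => runReward f n p.1 p.2.1 p.2.2
  | 0 => measurable_fst
  | n + 1 => by
    have ih := measurable_runReward f n
    have ha : Measurable fun p : ℝ × (Fin (n + 1) → Bool) × (Fin (n + 1) → ℝ) =>
        fun i : Fin n => p.2.1 i.succ := by fun_prop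
    have hx : Measurable fun p : ℝ × (Fin (n + 1) → Bool) × (Fin (n + 1) → ℝ) =>
        fun i : Fin n => p.2.2 i.succ := by fun_prop
    have hx0 : Measurable fun p : ℝ × (Fin (n + 1) → Bool) × (Fin (n + 1) → ℝ) => p.2.2 0 := by
      fun_prop
    have ha0 : Measurable fun p : ℝ × (Fin (n + 1) → Bool) × (Fin (n + 1) → ℝ) => p.2.1 0 := by
      fun_prop
    exact Measurable.ite (ha0 (measurableSet_singleton true))
      ((ih.comp (hx0.prodMk (ha.prodMk hx))).sub (measurable_fst.const_mul f))
      (ih.comp (measurable_fst.prodMk (ha.prodMk hx)))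

theorem abs_runReward_le {f : ℝ} (hf : 0 ≤ f) : ∀ (n : ℕ) (h : ℝ) (a : Fin n → Bool)
    (x : Fin n → ℝ), |runReward f n h a x| ≤ (1 + f) * (|h| + ∑ i, |x i|)
  | 0, h, _, _ => by
    have := mul_nonneg hf (abs_nonneg h)
    simp only [runReward, Finset.univ_eq_empty, Finset.sum_empty]
    linarith
  | n + 1, h, a, x => by
    rw [Fin.sum_univ_succ, runReward]
    have hfh := mul_nonneg hf (abs_nonneg h)
    have hfx := mul_nonneg hf (abs_nonneg (x 0))
    have h0 := abs_nonneg h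
    have hx := abs_nonneg (x 0)
    split_ifs
    · have ih := abs_runReward_le hf n (x 0) (fun i => a i.succ) (fun i => x i.succ)
      have h1 := abs_sub (runReward f n (x 0) (fun i => a i.succ) fun i => x i.succ) (f * h)
      rw [abs_mul, abs_of_nonneg hf] at h1
      linarith
    · have ih := abs_runReward_le hf n h (fun i => a i.succ) (fun i => x i.succ)
      linarith

theorem integrable_eval_pi {n : ℕ} {D : Fin n → Measure ℝ} (hD : ∀ i, IsPrizeLaw (D i))
    (i : Fin n) : Integrable (fun x : Fin n → ℝ => x i) (Measure.pi D) := by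
  have := fun i => (hD i).isProbabilityMeasure
  exact (measurePreserving_eval D i).integrable_comp_of_integrable (hD i).integrable

theorem integrable_runReward {f : ℝ} (hf : 0 ≤ f) {n : ℕ} {D : Fin n → Measure ℝ}
    (hD : ∀ i, IsPrizeLaw (D i)) {a : (Fin n → ℝ) → Fin n → Bool} (ha : Measurable a) (h : ℝ) :
    Integrable (fun x => runReward f n h (a x) x) (Measure.pi D) := by
  have := fun i => (hD i).isProbabilityMeasure
  refine Integrable.mono' (g := fun x => (1 + f) * (|h| + ∑ i, |x i|))
    (((integrable_const _).add
      (integrable_finsetSum _ fun i _ => (integrable_eval_pi hD i).abs)).const_mul _)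
    ((measurable_runReward f n).comp
      (measurable_const.prodMk (ha.prodMk measurable_id))).aestronglyMeasurable
    (ae_of_all _ fun x => abs_runReward_le hf n h (a x) x)

theorem measurable_finCons {n : ℕ} (t : ℝ) :
    Measurable fun y : Fin n → ℝ => (Fin.cons t y : Fin (n + 1) → ℝ) := by
  refine measurable_pi_lambda _ fun i => ?_
  cases i using Fin.cases with
  | zero => exact measurable_const
  | succ i => exact measurable_pi_apply i

theorem integral_pi_succ {n : ℕ} {D : Fin (n + 1) → Measure ℝ} (hD : ∀ i, IsPrizeLaw (D i))
    {g : (Fin (n + 1) → ℝ) → ℝ} (hg : Integrable g (Measure.pi D)) :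
    Integrable (fun t => ∫ y, g (Fin.cons t y) ∂(Measure.pi fun i => D i.succ)) (D 0) ∧
      ∫ x, g x ∂(Measure.pi D) =
        ∫ t, ∫ y, g (Fin.cons t y) ∂(Measure.pi fun i => D i.succ) ∂(D 0) := by
  have := fun i => (hD i).isProbabilityMeasure
  have hmp := (measurePreserving_piFinSuccAbove D 0).symm
  have hcons : ∀ p : ℝ × (Fin n → ℝ),
      (MeasurableEquiv.piFinSuccAbove (fun _ => ℝ) 0).symm p = Fin.cons p.1 p.2 := by
    intro p
    simp [MeasurableEquiv.piFinSuccAbove, Fin.insertNthEquiv, Fin.insertNth_zero']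
  have hi : Integrable (fun p : ℝ × (Fin n → ℝ) => g (Fin.cons p.1 p.2))
      ((D 0).prod (Measure.pi fun i => D i.succ)) := by
    have := hmp.integrable_comp_of_integrable hg
    simpa only [Function.comp_def, hcons, Fin.zero_succAbove] using this
  refine ⟨hi.integral_prod_left, ?_⟩
  rw [← integral_prod _ hi]
  have := hmp.integral_comp' (g := g)
  simpa only [hcons, Fin.zero_succAbove] using this.symm

/-- No online decision rule has a larger expected reward than the value of optimal play. -/
theorem integral_runReward_le_value {f : ℝ} (hf : 0 ≤ f) : ∀ (n : ℕ) (D : Fin n → Measure ℝ),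
    (∀ i, IsPrizeLaw (D i)) → ∀ a : (Fin n → ℝ) → Fin n → Bool, Measurable a →
    (∀ i x y, (∀ j ≤ i, x j = y j) → a x i = a y i) → ∀ h : ℝ,
    ∫ x, runReward f n h (a x) x ∂(Measure.pi D) ≤ value f (List.ofFn D) id h
  | 0, D, _, _, _, _, h => by
    have : ∀ i, IsProbabilityMeasure (D i) := fun i => i.elim0
    simp [runReward]
  | n + 1, D, hD, a, ha, hna, h => by
    have hprob := (hD 0).isProbabilityMeasure
    have hDt : ∀ i : Fin n, IsPrizeLaw (D i.succ) := fun i => hD i.succ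
    have hU : IsContinuationValue f (value f (List.ofFn fun i => D i.succ) id) :=
      (IsContinuationValue.id hf).value hf (by simpa [List.mem_ofFn] using hDt)
    obtain ⟨hi, heq⟩ := integral_pi_succ hD (integrable_runReward hf hD ha h)
    rw [heq, List.ofFn_succ, value_cons]
    refine integral_mono hi (hU.integrable_bellman hf (hD 0).integrable h) fun t => ?_
    have ha' : Measurable fun (y : Fin n → ℝ) (i : Fin n) => a (Fin.cons t y) i.succ :=
      measurable_pi_lambda _ fun i =>
        (measurable_pi_apply i.succ).comp (ha.comp (measurable_finCons t))
    have ih := integral_runReward_le_value hf n _ hDt _ ha' fun i x y hxy =>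
      hna _ _ _ fun j hj => by
        cases j using Fin.cases with
        | zero => rfl
        | succ j => exact hxy j (Fin.succ_le_succ_iff.1 hj)
    -- The first decision depends on `t` alone, so for fixed `t` a single branch applies to all
    -- futures `y`.
    have h0 : ∀ y : Fin n → ℝ, a (Fin.cons t y) 0 = a (Fin.cons t 0) 0 := fun y =>
      hna _ _ _ fun j hj => by rw [Fin.le_zero_iff.1 hj]; rfl
    simp only [runReward, h0, Fin.cons_zero, Fin.cons_succ]
    split_ifs
    · have hit := integrable_runReward hf hDt ha' t
      have : IsProbabilityMeasure (Measure.pi fun i : Fin n => D i.succ) := by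
        have := fun i => (hDt i).isProbabilityMeasure
        infer_instance
      rw [integral_sub hit (integrable_const _), integral_const, probReal_univ, one_smul]
      exact le_max_of_le_right (sub_le_sub_right (ih t) _)
    · exact le_max_of_le_left (ih h)

/-- The optimal decision rule. -/
noncomputable def greedyRule (f : ℝ) : (n : ℕ) → (Fin n → Measure ℝ) → ℝ → (Fin n → ℝ) →
    Fin n → Bool
  | 0, _, _, _ => fun i => i.elim0
  | n + 1, D, h, x =>
    if value f (List.ofFn fun i => D i.succ) id h <
        value f (List.ofFn fun i => D i.succ) id (x 0) - f * h then
      Fin.cons true (greedyRule f n (fun i => D i.succ) (x 0) fun i => x i.succ)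
    else Fin.cons false (greedyRule f n (fun i => D i.succ) h fun i => x i.succ)

theorem greedyRule_congr (f : ℝ) : ∀ (n : ℕ) (D : Fin n → Measure ℝ) (h : ℝ) (i : Fin n)
    (x y : Fin n → ℝ), (∀ j ≤ i, x j = y j) → greedyRule f n D h x i = greedyRule f n D h y i
  | 0, _, _, i, _, _, _ => i.elim0
  | n + 1, D, h, i, x, y, hxy => by
    rw [greedyRule, greedyRule, hxy 0 (Fin.zero_le i)]
    cases i using Fin.cases with
    | zero => split_ifs <;> rfl
    | succ i =>
      have ih := fun h => greedyRule_congr f n (fun i => D i.succ) h i (fun i => x i.succ)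
        (fun i => y i.succ) fun j hj => hxy _ (Fin.succ_le_succ_iff.2 hj)
      split_ifs <;> simp only [Fin.cons_succ, ih]

theorem measurable_greedyRule {f : ℝ} (hf : 0 ≤ f) : ∀ (n : ℕ) (D : Fin n → Measure ℝ),
    (∀ i, IsPrizeLaw (D i)) →
    Measurable fun p : ℝ × (Fin n → ℝ) => greedyRule f n D p.1 p.2
  | 0, _, _ => measurable_of_subsingleton_codomain _
  | n + 1, D, hD => by
    have hDt : ∀ i : Fin n, IsPrizeLaw (D i.succ) := fun i => hD i.succ
    have hU : IsContinuationValue f (value f (List.ofFn fun i => D i.succ) id) :=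
      (IsContinuationValue.id hf).value hf (by simpa [List.mem_ofFn] using hDt)
    have hUm := (hU.continuous hf).measurable
    have ih := measurable_greedyRule hf n _ hDt
    have hx : Measurable fun p : ℝ × (Fin (n + 1) → ℝ) => fun i : Fin n => p.2 i.succ := by
      fun_prop
    have hx0 : Measurable fun p : ℝ × (Fin (n + 1) → ℝ) => p.2 0 := by fun_prop
    have hcons : ∀ b : Bool, Measurable fun c : Fin n → Bool =>
        (Fin.cons b c : Fin (n + 1) → Bool) := by
      refine fun b => measurable_pi_lambda _ fun i => ?_
      cases i using Fin.cases with
      | zero => exact measurable_const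
      | succ i => exact measurable_pi_apply i
    exact Measurable.ite (measurableSet_lt (hUm.comp measurable_fst)
        ((hUm.comp hx0).sub (measurable_fst.const_mul f)))
      ((hcons true).comp (ih.comp (hx0.prodMk hx)))
      ((hcons false).comp (ih.comp (measurable_fst.prodMk hx)))

/-- In each round the rule takes the branch that attains the maximum in the Bellman operator. -/
theorem integral_runReward_greedyRule {f : ℝ} (hf : 0 ≤ f) : ∀ (n : ℕ) (D : Fin n → Measure ℝ),
    (∀ i, IsPrizeLaw (D i)) → ∀ h : ℝ,
    ∫ x, runReward f n h (greedyRule f n D h x) x ∂(Measure.pi D) = value f (List.ofFn D) id h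
  | 0, D, _, h => by
    have : ∀ i, IsProbabilityMeasure (D i) := fun i => i.elim0
    simp [runReward]
  | n + 1, D, hD, h => by
    have hDt : ∀ i : Fin n, IsPrizeLaw (D i.succ) := fun i => hD i.succ
    have hmeas : ∀ (n : ℕ) (D : Fin n → Measure ℝ), (∀ i, IsPrizeLaw (D i)) → ∀ h,
        Measurable (greedyRule f n D h) := fun n D hD h =>
      (measurable_greedyRule hf n D hD).comp (measurable_const.prodMk measurable_id)
    rw [(integral_pi_succ hD (integrable_runReward hf hD (hmeas _ D hD h) h)).2, List.ofFn_succ,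
      value_cons, bellman]
    congr 1 with t
    have ih := integral_runReward_greedyRule hf n _ hDt
    simp only [greedyRule, Fin.cons_zero, Fin.cons_succ]
    split_ifs with hlt
    · have hit := integrable_runReward hf hDt (hmeas n _ hDt t) t
      have : IsProbabilityMeasure (Measure.pi fun i : Fin n => D i.succ) := by
        have := fun i => (hDt i).isProbabilityMeasure
        infer_instance
      simp only [runReward, Fin.cons_zero, Fin.cons_succ, if_true]
      rw [integral_sub hit (integrable_const _), ih, integral_const, probReal_univ, one_smul,
        max_eq_right hlt.le]
    · simp only [runReward, Fin.cons_zero, Fin.cons_succ, Bool.false_eq_true, if_false]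
      rw [ih, max_eq_left (not_lt.1 hlt)]

/-! ### The prophet as a player without cancellation costs -/

/-- For `n = 0` the supremum on the right is the default `0`, which `h ≥ 0` absorbs. -/
theorem max_iSup_fin_succ {n : ℕ} {h : ℝ} (hh : 0 ≤ h) (x : Fin (n + 1) → ℝ) :
    max h (⨆ i, x i) = max (max h (x 0)) (⨆ i : Fin n, x i.succ) := by
  have hb : BddAbove (Set.range x) := Set.finite_range x |>.bddAbove
  have hb' : BddAbove (Set.range fun i : Fin n => x i.succ) := (Set.finite_range _).bddAbove
  refine le_antisymm (max_le (le_max_of_le_left (le_max_left _ _)) (ciSup_le fun i => ?_))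
    (max_le (max_le (le_max_left _ _) (le_max_of_le_right (le_ciSup hb 0)))
      (Real.iSup_le (fun i => le_max_of_le_right (le_ciSup hb i.succ)) (le_max_of_le_left hh)))
  cases i using Fin.cases with
  | zero => exact le_max_of_le_left (le_max_right _ _)
  | succ i => exact le_max_of_le_right (le_ciSup hb' i)

theorem integrable_max_iSup {n : ℕ} {D : Fin n → Measure ℝ} (hD : ∀ i, IsPrizeLaw (D i)) {h : ℝ}
    (hh : 0 ≤ h) : Integrable (fun x : Fin n → ℝ => max h (⨆ i, x i)) (Measure.pi D) := by
  have := fun i => (hD i).isProbabilityMeasure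
  refine Integrable.mono' (g := fun x => h + ∑ i, |x i|)
    ((integrable_const _).add (integrable_finsetSum _ fun i _ => (integrable_eval_pi hD i).abs))
    (measurable_const.max (.iSup fun i => measurable_pi_apply i)).aestronglyMeasurable
    (ae_of_all _ fun x => ?_)
  have hs : 0 ≤ ∑ i, |x i| := Finset.sum_nonneg fun i _ => abs_nonneg _
  rw [Real.norm_of_nonneg (le_max_of_le_left hh)]
  refine max_le (by linarith) (Real.iSup_le (fun i => ?_) (by linarith))
  have h1 : |x i| ≤ ∑ i, |x i| := Finset.single_le_sum (f := fun i => |x i|)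
    (fun i _ => abs_nonneg _) (Finset.mem_univ i)
  linarith [le_abs_self (x i)]

/-- For `f = 0` value functions are monotone, so `max (U h) (U x) = U (max h x)` and the recursion
tracks the running maximum. -/
theorem integral_max_iSup : ∀ (n : ℕ) (D : Fin n → Measure ℝ), (∀ i, IsPrizeLaw (D i)) →
    ∀ h : ℝ, 0 ≤ h → ∫ x, max h (⨆ i, x i) ∂(Measure.pi D) = value 0 (List.ofFn D) id h
  | 0, D, _, h, hh => by
    have : ∀ i, IsProbabilityMeasure (D i) := fun i => i.elim0
    simp [hh]
  | n + 1, D, hD, h, hh => by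
    have hDt : ∀ i : Fin n, IsPrizeLaw (D i.succ) := fun i => hD i.succ
    have hU : IsContinuationValue 0 (value 0 (List.ofFn fun i => D i.succ) id) :=
      (IsContinuationValue.id le_rfl).value le_rfl (by simpa [List.mem_ofFn] using hDt)
    rw [(integral_pi_succ hD (integrable_max_iSup hD hh)).2, List.ofFn_succ, value_cons, bellman]
    congr 1 with t
    simp only [max_iSup_fin_succ hh, Fin.cons_zero, Fin.cons_succ]
    rw [integral_max_iSup n _ hDt _ (le_max_of_le_left hh), hU.mono_of_zero.map_max]
    simp

/-- The prophet's reward is the value of optimal play without cancellation costs. -/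
theorem prophetValue_eq_value {n : ℕ} {D : Fin n → Measure ℝ} (hD : ∀ i, IsPrizeLaw (D i)) :
    prophetValue D = value 0 (List.ofFn D) id 0 := by
  have := fun i => (hD i).isProbabilityMeasure
  rw [← integral_max_iSup n D hD 0 le_rfl, prophetValue]
  refine integral_congr_ae ?_
  have hnn : ∀ᵐ x ∂(Measure.pi D), ∀ i, 0 ≤ x i := ae_all_iff.2 fun i =>
    (measurePreserving_eval D i).quasiMeasurePreserving.ae (hD i).nonneg
  filter_upwards [hnn] with x hx
  exact (max_eq_right (Real.iSup_nonneg hx)).symm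

/-! ### Online policies and the conclusion -/

/-- Randomization does not help: for each fixed seed the policy is a deterministic online rule. -/
theorem OnlinePolicy.expectedReward_le_value {f : ℝ} (hf : 0 ≤ f) {n : ℕ} (π : OnlinePolicy n)
    {D : Fin n → Measure ℝ} (hD : ∀ i, IsPrizeLaw (D i)) :
    π.expectedReward f D ≤ value f (List.ofFn D) id 0 := by
  have := fun i => (hD i).isProbabilityMeasure
  by_cases hi : Integrable (fun p : unitInterval × (Fin n → ℝ) => π.netReward f p.1 p.2)
      ((volume : Measure unitInterval).prod (Measure.pi D))
  · rw [OnlinePolicy.expectedReward, integral_prod _ hi]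
    calc _ ≤ ∫ _ : unitInterval, value f (List.ofFn D) id 0 := by
          refine integral_mono hi.integral_prod_left (integrable_const _) fun s => ?_
          simp only [π.netReward_eq_runReward]
          refine integral_runReward_le_value hf n D hD
            (fun x i => π.accept i (s, fun j => x j)) ?_ (fun i x y hxy => ?_) 0
          · exact measurable_pi_lambda _ fun i => (π.measurable_accept i).comp
              (measurable_const.prodMk (measurable_pi_lambda _ fun j => measurable_pi_apply _))
          · congr 2
            exact funext fun j => hxy j j.2
      _ = _ := by simp
  -- Without integrability the integral is `0` by convention, which the value of optimal play is
  -- never below.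
  · rw [OnlinePolicy.expectedReward, integral_undef hi]
    exact le_value hf (.id hf) (by simpa [List.mem_ofFn] using hD) 0

theorem exists_onlinePolicy_expectedReward_eq {f : ℝ} (hf : 0 ≤ f) {n : ℕ}
    {D : Fin n → Measure ℝ} (hD : ∀ i, IsPrizeLaw (D i)) :
    ∃ π : OnlinePolicy n, π.expectedReward f D = value f (List.ofFn D) id 0 := by
  have := fun i => (hD i).isProbabilityMeasure
  -- Pads the observed values with `0`; by `greedyRule_congr` the padding does not affect the
  -- decision in round `i`.
  let past (i : Fin n) (y : {j : Fin n // j ≤ i} → ℝ) (j : Fin n) : ℝ :=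
    if hj : j ≤ i then y ⟨j, hj⟩ else 0
  have hpast : ∀ i, Measurable (past i) := by
    refine fun i => measurable_pi_lambda _ fun j => ?_
    by_cases hj : j ≤ i
    · simpa only [past, hj, dite_true] using measurable_pi_apply _
    · simpa only [past, hj, dite_false] using measurable_const
  let π : OnlinePolicy n :=
    { accept := fun i p => greedyRule f n D 0 (past i p.2) i
      measurable_accept := fun i => (measurable_pi_apply i).comp
        ((measurable_greedyRule hf n D hD).comp
          (measurable_const.prodMk ((hpast i).comp measurable_snd))) }
  refine ⟨π, ?_⟩
  have hπ : ∀ s x, π.netReward f s x = runReward f n 0 (greedyRule f n D 0 x) x := by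
    intro s x
    rw [π.netReward_eq_runReward]
    congr 1
    exact funext fun i => greedyRule_congr f n D 0 i _ _ fun j hj => by simp [past, hj]
  simp only [OnlinePolicy.expectedReward, hπ]
  rw [integral_fun_snd (fun x => runReward f n 0 (greedyRule f n D 0 x) x), probReal_univ,
    one_smul, integral_runReward_greedyRule hf n D hD]

theorem achievesRatio_iff {f : ℝ} (hf : 0 ≤ f) (α : ℝ) {n : ℕ} {D : Fin n → Measure ℝ}
    (hD : ∀ i, IsPrizeLaw (D i)) : AchievesRatio f α D ↔
      α * value 0 (List.ofFn D) id 0 ≤ value f (List.ofFn D) id 0 := by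
  rw [AchievesRatio, prophetValue_eq_value hD]
  refine ⟨fun ⟨π, hπ⟩ => hπ.trans (π.expectedReward_le_value hf hD), fun h => ?_⟩
  obtain ⟨π, hπ⟩ := exists_onlinePolicy_expectedReward_eq hf hD
  exact ⟨π, h.trans hπ.ge⟩

theorem mainTheorem5 (f : ℝ) (hf : 0 ≤ f) (α : ℝ)
    (hBer : ∀ (n : ℕ) (v : Fin n → ℝ) (q : Fin n → unitInterval),
      (∀ i, 0 < v i) → Monotone v → AchievesRatio f α (fun i => scaledBernoulli (v i) (q i))) :
    ∀ (n : ℕ) (D : Fin n → Measure ℝ), (∀ i, IsProbabilityMeasure (D i)) →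
      (∀ i, ∀ᵐ x ∂(D i), 0 ≤ x) → (∀ i, Integrable (fun x : ℝ => x) (D i)) →
      AchievesRatio f α D := by
  intro n D hprob hnn hint
  have hD : ∀ i, IsPrizeLaw (D i) := fun i => ⟨hprob i, hnn i, hint i⟩
  have hDs : ∀ E ∈ List.ofFn D, IsPrizeLaw E := by simpa [List.mem_ofFn] using hD
  rw [achievesRatio_iff hf α hD]
  -- The reduction multiplies an inequality between benchmarks by `α`, so it needs `α ≥ 0`. For `α ≤
  -- 0` it is enough that both values are nonnegative.
  rcases le_total α 0 with hα | hα
  · exact (mul_nonpos_of_nonpos_of_nonneg hα (le_value le_rfl (.id le_rfl) hDs 0)).trans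
      (le_value hf (.id hf) hDs 0)
  refine mul_value_zero_le_value hf hα (fun L hL hs => ?_) _ hDs
  have hpos : ∀ i : Fin L.length, 0 < (L.get i).1 := fun i => hL _ (L.get_mem i)
  have hmono : Monotone fun i : Fin L.length => (L.get i).1 := fun i j hij =>
    hij.eq_or_lt.elim (fun h => h ▸ le_rfl) (List.pairwise_iff_get.1 hs i j)
  have hofFn : (List.ofFn fun i : Fin L.length => scaledBernoulli (L.get i).1 (L.get i).2) =
      bernoulliRounds L := by
    conv_rhs => rw [← List.ofFn_get L]
    rw [bernoulliRounds, List.map_ofFn]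
    rfl
  have h := hBer L.length (fun i => (L.get i).1) (fun i => (L.get i).2) hpos hmono
  rwa [achievesRatio_iff hf α fun i => isPrizeLaw_scaledBernoulli (hpos i).le _, hofFn] at h
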